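/- Let $k$ be a field, let $\ell\ge 1$ and $\sigma_1\ge\dots\ge\sigma_\ell\ge 1$ be integers, and let $n\ge 2$ be an integer. Let $S=k[T_{i,j}\mid 1\le i\le \ell,\ 1\le j\le \sigma_i+1]$, and let $\psi=[\psi_1|\cdots|\psi_\ell]$ be the scroll matrix, where $$\psi_u=\begin{bmatrix}T_{u,1}&T_{u,2}&\dots&T_{u,\sigma_u}\\ T_{u,2}&T_{u,3}&\dots&T_{u,\sigma_u+1}\end{bmatrix}.$$ Let $G$ be the set of $2\times 2$ minors of $\psi$ (one for each pair of columns), let $H=I_2(\psi)$ be the ideal of $S$ generated by $G$, let $A=S/H$, let $K$ be the (prime) ideal of $A$ generated by the images of the entries of the top row of $\psi$, and let $K^{(n)}=K^nA_K\cap A$ be its $n$-th symbolic power. For $0\le m\le \ell-1$, call an $m$-tuple $\mathbf a=(a_1,\dots,a_m)$ of non-negative integers eligible if $\sum_{u=1}^m a_u\sigma_u<n$. For an eligible $m$-tuple $\mathbf a$ let $f(\mathbf a)$ be the non-negative integer with $$\sum_{u=1}^m a_u\sigma_u+f(\mathbf a)\sigma_{m+1}<n\le \sum_{u=1}^m a_u\sigma_u+(f(\mathbf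 a)+1)\sigma_{m+1},$$ and put $r(\mathbf a)=\sum_{u=1}^m a_u\sigma_u+(f(\mathbf a)+1)\sigma_{m+1}-n+1$ and $T^{\mathbf a}=\prod_{u=1}^m T_{u,1}^{a_u}$. Let $$\mathcal L=\bigcup_{m=0}^{\ell-1}\bigl\{T^{\mathbf a}\,T_{m+1,1}^{f(\mathbf a)}\,T_{m+1,u}\;\bigm|\;\mathbf a\text{ is an eligible }m\text{-tuple and }1\le u\le r(\mathbf a)\bigr\}.$$ Order the variables by $T_{1,1}>T_{1,2}>\dots>T_{1,\sigma_1+1}>T_{2,1}>\dots>T_{\ell,\sigma_\ell+1}$ and give the monomials of $S$ the (graded) reverse lexicographic order: $M_1>M_2$ if and only if either $\deg M_1>\deg M_2$, or $\deg M_1=\deg M_2$ and, for the smallest variable whose exponents in $M_1$ and $M_2$ differ, the exponent in $M_1$ is the smaller one. Then $G\cup\mathcal L$ is a Gröbner basis of the preimage of $K^{(n)}$ in $S$; that is, $G\cup\mathcal L$ is a finite subset of this preimage, and the leading terms of its elements generate the ideal generated by the leading terms of all elements of the preimage. -/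

import Mathlib

open MvPolynomial

/-! ### The graded reverse lexicographic order -/

/-- Monomials (exponent vectors), to be ordered by the graded reverse lexicographic order. -/
def DegRevLex (ι : Type*) : Type _ := ι →₀ ℕ

namespace DegRevLex

variable {ι : Type*}

noncomputable instance : AddCommMonoid (DegRevLex ι) :=
  inferInstanceAs (AddCommMonoid (ι →₀ ℕ))

/-- Regard an exponent vector as an element of `DegRevLex`. -/
noncomputable def of : (ι →₀ ℕ) ≃+ DegRevLex ι := AddEquiv.refl _

/-- Compare total degrees first; in case of a tie, reverse the comparison of exponents
at the last position where the exponent vectors differ. -/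
noncomputable def key (a : DegRevLex ι) : ℕ ×ₗ (Colex (ι →₀ ℕ))ᵒᵈ :=
  toLex ((of.symm a).degree, OrderDual.toDual (toColex (of.symm a)))

theorem key_injective : Function.Injective (key (ι := ι)) := by
  intro a b h
  have h2 := congrArg (fun x => OrderDual.ofDual (ofLex x).2) h
  exact h2

noncomputable instance [LinearOrder ι] : LinearOrder (DegRevLex ι) :=
  LinearOrder.lift' key key_injective

theorem lt_iff [LinearOrder ι] (a b : ι →₀ ℕ) :
    of a < of b ↔ a.degree < b.degree ∨
      (a.degree = b.degree ∧ ∃ i, (∀ j, i < j → a j = b j) ∧ b i < a i) := by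
  change key (of a) < key (of b) ↔ _
  rw [key, key, Prod.Lex.toLex_lt_toLex]
  simp only [AddEquiv.symm_apply_apply, OrderDual.toDual_lt_toDual, Finsupp.Colex.lt_iff]
  refine or_congr_right (and_congr_right fun _ => exists_congr fun i => and_congr_left fun _ => ?_)
  exact forall_congr' fun j => imp_congr_right fun _ => eq_comm

theorem add_lt_add_of_lt [LinearOrder ι] (a b c : ι →₀ ℕ) (h : of a < of b) :
    of (c + a) < of (c + b) := by
  rw [lt_iff] at h ⊢
  simpa using h

instance [LinearOrder ι] : IsOrderedAddMonoid (DegRevLex ι) where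
  add_le_add_left a b h c := by
    rcases h.eq_or_lt with h | h
    · rw [h]
    · have := add_lt_add_of_lt (of.symm a) (of.symm b) (of.symm c) h
      rw [add_comm a c, add_comm b c]
      exact this.le

theorem of_monotone [LinearOrder ι] : Monotone (of (ι := ι)) := by
  intro a b h
  obtain ⟨c, rfl⟩ := exists_add_of_le h
  rcases eq_or_ne c 0 with rfl | hc
  · simp
  · refine le_of_lt ((lt_iff _ _).2 (Or.inl ?_))
    have : 0 < c.degree := Nat.pos_of_ne_zero fun h0 => hc ((Finsupp.degree_eq_zero_iff c).1 h0)
    simpa using this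

instance [LinearOrder ι] [Finite ι] : WellFoundedLT (DegRevLex ι) :=
  haveI : WellQuasiOrderedLE (DegRevLex ι) :=
    Monotone.wellQuasiOrderedLE_of_wellQuasiOrderedLE_of_surjective of_monotone (of (ι := ι)).surjective
  inferInstance

end DegRevLex

/-- The (graded) reverse lexicographic order on the monomials in finitely many linearly ordered
variables, where a variable with a *smaller* index is the *larger* variable:
`a` is smaller than `b` iff `deg a < deg b`, or `deg a = deg b` and the last non-zero entry of
`b - a` is negative (see `degRevLex_lt_iff`). -/
noncomputable def degRevLex (ι : Type*) [LinearOrder ι] [Finite ι] : MonomialOrder ι where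
  syn := DegRevLex ι
  toSyn := DegRevLex.of
  toSyn_monotone := DegRevLex.of_monotone

theorem degRevLex_lt_iff {ι : Type*} [LinearOrder ι] [Finite ι] (a b : ι →₀ ℕ) :
    (degRevLex ι).toSyn a < (degRevLex ι).toSyn b ↔ a.degree < b.degree ∨
      (a.degree = b.degree ∧ ∃ i, (∀ j, i < j → a j = b j) ∧ b i < a i) :=
  DegRevLex.lt_iff a b

/-! ### Gröbner bases -/

/-- `G` is a Gröbner basis of the ideal `I` with respect to the monomial order `m`: it is a finite
subset of `I` whose leading terms generate the ideal of leading terms of `I`. -/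
def IsGroebnerBasis {ι k : Type*} [Field k] (m : MonomialOrder ι)
    (G : Set (MvPolynomial ι k)) (I : Ideal (MvPolynomial ι k)) : Prop :=
  G.Finite ∧ G ⊆ (I : Set (MvPolynomial ι k)) ∧
    Ideal.span (m.leadingTerm '' G) = Ideal.span (m.leadingTerm '' (I : Set (MvPolynomial ι k)))

/-! ### Symbolic powers -/

/-- The `n`-th symbolic power `P⁽ⁿ⁾ = PⁿA_P ∩ A` of a prime ideal `P` of `A`. -/
noncomputable def symbolicPower {A : Type*} [CommRing A] (P : Ideal A) [P.IsPrime] (n : ℕ) :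
    Ideal A :=
  ((P ^ n).map (algebraMap A (Localization.AtPrime P))).comap
    (algebraMap A (Localization.AtPrime P))

/-! ### Rational normal scrolls -/

namespace Scroll

variable {l : ℕ}

/-- The index type of the variables `T_{i,j}`, `1 ≤ i ≤ l`, `1 ≤ j ≤ σ_i + 1`, in lexicographic
order. Both indices are counted from `0`: `T_{i,j}` corresponds to `(i - 1, j - 1)`. -/
abbrev Var (σ : Fin l → ℕ) : Type := Σₗ i : Fin l, Fin (σ i + 1)

/-- The index type of the columns of the scroll matrix, from left to right: block `i` has `σ_i`
columns. -/
abbrev Col (σ : Fin l → ℕ) : Type := Σₗ i : Fin l, Fin (σ i)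

instance (σ : Fin l → ℕ) : Finite (Var σ) :=
  inferInstanceAs (Finite (Sigma fun i : Fin l => Fin (σ i + 1)))

/-- The variable index `(i, j)`, counted from `0`. -/
def var (σ : Fin l → ℕ) (i : Fin l) (j : Fin (σ i + 1)) : Var σ := toLex ⟨i, j⟩

/-- The scroll matrix `ψ`: the column with index `(i, j)` has entries `T_{i,j}` (top) and
`T_{i,j+1}` (bottom). -/
noncomputable def psi (k : Type*) [Field k] (σ : Fin l → ℕ) :
    Matrix (Fin 2) (Col σ) (MvPolynomial (Var σ) k) :=
  Matrix.of ![fun c => X (var σ (ofLex c).1 (ofLex c).2.castSucc),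
    fun c => X (var σ (ofLex c).1 (ofLex c).2.succ)]

/-- The set `G` of `2 × 2` minors of `ψ`. -/
def minors (k : Type*) [Field k] (σ : Fin l → ℕ) : Set (MvPolynomial (Var σ) k) :=
  {g | ∃ c d : Col σ, c < d ∧ g = ((psi k σ).submatrix id ![c, d]).det}

/-- The ideal `H = I₂(ψ)`. -/
noncomputable def H (k : Type*) [Field k] (σ : Fin l → ℕ) : Ideal (MvPolynomial (Var σ) k) :=
  Ideal.span (minors k σ)

/-- The ring `A = S / I₂(ψ)`. -/
abbrev A (k : Type*) [Field k] (σ : Fin l → ℕ) : Type _ := MvPolynomial (Var σ) k ⧸ H k σ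

/-- The ideal `K` of `A` generated by the images of the entries of the top row of `ψ`. -/
noncomputable def K (k : Type*) [Field k] (σ : Fin l → ℕ) : Ideal (A k σ) :=
  Ideal.span (Set.range fun c : Col σ => Ideal.Quotient.mk (H k σ) (psi k σ 0 c))

/-- An ideal generated by variables is prime. -/
theorem isPrime_span_X {ι k : Type*} [Field k] (s : Set ι) :
    (Ideal.span ((X : ι → MvPolynomial ι k) '' s)).IsPrime := by
  classical
  set I := Ideal.span ((X : ι → MvPolynomial ι k) '' s) with hI
  let φ : MvPolynomial ι k →ₐ[k] MvPolynomial ι k := aeval fun i => if i ∈ s then 0 else X i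
  have hmk : (Ideal.Quotient.mkₐ k I).comp φ = Ideal.Quotient.mkₐ k I := by
    ext i
    by_cases hi : i ∈ s
    · have : X i ∈ I := Ideal.subset_span ⟨i, hi, rfl⟩
      simp [φ, hi, Ideal.Quotient.eq_zero_iff_mem.2 this]
    · simp [φ, hi]
  have hker : I = RingHom.ker φ := by
    apply le_antisymm
    · rw [hI, Ideal.span_le]
      rintro _ ⟨i, hi, rfl⟩
      simp [φ, hi, RingHom.mem_ker]
    · intro p hp
      have h := DFunLike.congr_fun hmk p
      rw [AlgHom.comp_apply, (RingHom.mem_ker).1 hp, map_zero] at h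
      exact Ideal.Quotient.eq_zero_iff_mem.1 h.symm
  rw [hker]
  exact RingHom.ker_isPrime φ

/-- `K` is a prime ideal, so that its symbolic powers are defined. -/
instance K_isPrime (k : Type*) [Field k] (σ : Fin l → ℕ) : (K k σ).IsPrime := by
  have hspan : Set.range (fun c : Col σ => psi k σ 0 c) =
      X '' Set.range (fun c : Col σ => var σ (ofLex c).1 (ofLex c).2.castSucc) := by
    rw [← Set.range_comp]
    rfl
  have hK : K k σ = (Ideal.span (Set.range fun c : Col σ => psi k σ 0 c)).map
      (Ideal.Quotient.mk (H k σ)) := by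
    rw [Ideal.map_span, ← Set.range_comp]
    rfl
  have hP : (Ideal.span (Set.range fun c : Col σ => psi k σ 0 c)).IsPrime := by
    rw [hspan]
    exact isPrime_span_X _
  rw [hK]
  refine Ideal.map_isPrime_of_surjective Ideal.Quotient.mk_surjective ?_
  rw [Ideal.mk_ker, H, Ideal.span_le]
  rintro _ ⟨c, d, -, rfl⟩
  rw [Matrix.det_fin_two]
  refine Ideal.sub_mem _ (Ideal.mul_mem_right _ _ (Ideal.subset_span ⟨c, rfl⟩))
    (Ideal.mul_mem_right _ _ (Ideal.subset_span ⟨d, rfl⟩))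

/-- The weight `a_1 σ_1 + ⋯ + a_m σ_m` of an `m`-tuple `a`, where `0 ≤ m ≤ l - 1`. -/
def weight (σ : Fin l → ℕ) (m : Fin l) (a : Fin m → ℕ) : ℕ :=
  ∑ u : Fin m, a u * σ (u.castLE m.isLt.le)

/-- The `m`-tuple `a` of non-negative integers, `0 ≤ m ≤ l - 1`, is eligible (for `n`). -/
def Eligible (σ : Fin l → ℕ) (n : ℕ) (m : Fin l) (a : Fin m → ℕ) : Prop :=
  weight σ m a < n

/-- The integer `f(a)`; for an eligible `m`-tuple `a` it is determined by
`weight a + f(a) σ_{m+1} < n ≤ weight a + (f(a) + 1) σ_{m+1}` (see `eligibleF_spec`,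
`eligibleF_unique`). Note that `σ_{m+1}` is `σ m` when indices are counted from `0`. -/
def eligibleF (σ : Fin l → ℕ) (n : ℕ) (m : Fin l) (a : Fin m → ℕ) : ℕ :=
  (n - 1 - weight σ m a) / σ m

/-- The integer `r(a) = weight a + (f(a) + 1) σ_{m+1} - n + 1` of an eligible tuple `a`. -/
def eligibleR (σ : Fin l → ℕ) (n : ℕ) (m : Fin l) (a : Fin m → ℕ) : ℕ :=
  weight σ m a + (eligibleF σ n m a + 1) * σ m + 1 - n

theorem eligibleF_spec (σ : Fin l → ℕ) (n : ℕ) (m : Fin l) (a : Fin m → ℕ) (hσ : 1 ≤ σ m)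
    (h : Eligible σ n m a) :
    weight σ m a + eligibleF σ n m a * σ m < n ∧
      n ≤ weight σ m a + (eligibleF σ n m a + 1) * σ m := by
  unfold Eligible at h
  have h1 : eligibleF σ n m a * σ m ≤ n - 1 - weight σ m a := Nat.div_mul_le_self _ _
  have h2 : n - 1 - weight σ m a < (eligibleF σ n m a + 1) * σ m := by
    rw [mul_comm]; exact Nat.lt_mul_div_succ _ hσ
  omega

theorem eligibleF_unique (σ : Fin l → ℕ) (n : ℕ) (m : Fin l) (a : Fin m → ℕ) (f : ℕ)
    (h1 : weight σ m a + f * σ m < n) (h2 : n ≤ weight σ m a + (f + 1) * σ m) :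
    eligibleF σ n m a = f := by
  unfold eligibleF
  apply Nat.div_eq_of_lt_le <;> omega

/-- The list `𝓛` of monomials `T^a T_{m+1,1}^{f(a)} T_{m+1,u}`, where `0 ≤ m ≤ l - 1`, `a` is an
eligible `m`-tuple, `T^a = T_{1,1}^{a_1} ⋯ T_{m,1}^{a_m}`, and `1 ≤ u ≤ r(a)`.
Here `u` is counted from `0`. -/
def monomials (k : Type*) [Field k] (σ : Fin l → ℕ) (n : ℕ) : Set (MvPolynomial (Var σ) k) :=
  {M | ∃ (m : Fin l) (a : Fin m → ℕ) (u : Fin (σ m + 1)),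
    Eligible σ n m a ∧ (u : ℕ) + 1 ≤ eligibleR σ n m a ∧
    M = (∏ i : Fin m, X (var σ (i.castLE m.isLt.le) 0) ^ a i) *
      X (var σ m 0) ^ eligibleF σ n m a * X (var σ m u)}

end Scroll

namespace Scroll

variable {l : ℕ} {σ : Fin l → ℕ}

/-! The scroll is parametrized by `T_{i,j} ↦ x_i s^{σ_i - j}`, indices counted from `0`. A monomial
goes to `x^d s^w`, with `d` its `blockDegree` and `w` its `rowWeight`; the minors go to `0`.
Elements of `K^(n)` go to multiples of `s^n` (`X_pow_dvd_param`), and every monomial with `w ≥ n`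
lies in `K^(n)` (`monomial_mem_symbolicPower`).

Call a monomial standard if no leading monomial of a minor divides it. It is then the smallest
monomial with its `d` and `w` (`IsStandard.le`). Hence, if the leading monomial of some nonzero `p`
in the preimage is standard, its image cannot cancel in `param k σ p`, so its weight is at least `n`
(`le_rowWeight_degree`). A standard monomial of weight at least `n` is divisible by an element of
`𝓛` (`IsStandard.exists_exponent_le`). A leading monomial that is not standard is divisible by that
of a minor. -/

theorem var_lt_var {i i' : Fin l} {j : Fin (σ i + 1)} {j' : Fin (σ i' + 1)} :
    var σ i j < var σ i' j' ↔ i < i' ∨ (i = i' ∧ (j : ℕ) < j') := by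
  constructor
  · rintro (⟨_, _, h⟩ | ⟨_, _, h⟩)
    · exact Or.inl h
    · exact Or.inr ⟨rfl, h⟩
  · rintro (h | ⟨rfl, h⟩)
    · exact Sigma.Lex.left _ _ h
    · exact Sigma.Lex.right _ _ h

theorem var_injective {i i' : Fin l} {j : Fin (σ i + 1)} {j' : Fin (σ i' + 1)}
    (h : var σ i j = var σ i' j') : i = i' ∧ (j : ℕ) = j' := by
  have h' : (⟨i, j⟩ : Σ i, Fin (σ i + 1)) = ⟨i', j'⟩ := toLex.injective h
  obtain ⟨rfl, h⟩ := Sigma.mk.inj_iff.1 h'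
  exact ⟨rfl, by rw [eq_of_heq h]⟩

theorem var_inj {i : Fin l} {j j' : Fin (σ i + 1)} : var σ i j = var σ i j' ↔ j = j' :=
  ⟨fun h => Fin.ext (var_injective h).2, fun h => h ▸ rfl⟩

/-! ### Leading monomials of the minors -/

/-- The variable in the top row of a column of the scroll matrix. -/
def top (c : Col σ) : Var σ := var σ (ofLex c).1 (ofLex c).2.castSucc

/-- The variable in the bottom row of a column of the scroll matrix. -/
def bot (c : Col σ) : Var σ := var σ (ofLex c).1 (ofLex c).2.succ

theorem top_lt_bot (c : Col σ) : top c < bot c :=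
  var_lt_var.2 (Or.inr ⟨rfl, by simp⟩)

theorem bot_lt_bot {c d : Col σ} (h : c < d) : bot c < bot d := by
  obtain ⟨_, _, h⟩ | ⟨_, _, h⟩ := h
  · exact var_lt_var.2 (Or.inl h)
  · exact var_lt_var.2 (Or.inr ⟨rfl, Nat.succ_lt_succ h⟩)

/-- The exponent of the leading monomial of the minor with columns `c < d`. -/
noncomputable def antidiagonal (c d : Col σ) : Var σ →₀ ℕ :=
  Finsupp.single (bot c) 1 + Finsupp.single (top d) 1

/-- The exponent of the other monomial of the minor with columns `c < d`. -/
noncomputable def diagonal (c d : Col σ) : Var σ →₀ ℕ :=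
  Finsupp.single (top c) 1 + Finsupp.single (bot d) 1

theorem minor_eq (k : Type*) [Field k] (c d : Col σ) :
    ((psi k σ).submatrix id ![c, d]).det =
      monomial (diagonal c d) 1 - monomial (antidiagonal c d) 1 := by
  rw [Matrix.det_fin_two, diagonal, antidiagonal, add_comm (Finsupp.single (bot c) 1)]
  simp [psi, top, bot, X]

/-- Of the four entries of the minor, `bot d` is the smallest variable, and it divides only the
diagonal term. -/
theorem diagonal_lt_antidiagonal {c d : Col σ} (h : c < d) :
    (degRevLex (Var σ)).toSyn (diagonal c d) < (degRevLex (Var σ)).toSyn (antidiagonal c d) := by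
  rw [degRevLex_lt_iff]
  refine Or.inr ⟨by simp [diagonal, antidiagonal], bot d, fun j hj => ?_, ?_⟩
  · have h1 : bot c ≠ j := ((bot_lt_bot h).trans hj).ne
    have h2 : top c ≠ j := ((top_lt_bot c).trans ((bot_lt_bot h).trans hj)).ne
    have h3 : top d ≠ j := ((top_lt_bot d).trans hj).ne
    simp [diagonal, antidiagonal, h1, h2, h3, hj.ne]
  · have h1 : bot c ≠ bot d := (bot_lt_bot h).ne
    have h3 : top d ≠ bot d := (top_lt_bot d).ne
    simp [diagonal, antidiagonal, Finsupp.single_apply, h1, h3]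

theorem degree_minor (k : Type*) [Field k] {c d : Col σ} (h : c < d) :
    (degRevLex (Var σ)).degree ((psi k σ).submatrix id ![c, d]).det = antidiagonal c d := by
  classical
  rw [minor_eq, ← neg_sub, MonomialOrder.degree_neg, MonomialOrder.degree_sub_of_lt]
  · simp [MonomialOrder.degree_monomial]
  · simpa [MonomialOrder.degree_monomial] using diagonal_lt_antidiagonal h

theorem minor_ne_zero (k : Type*) [Field k] {c d : Col σ} (h : c < d) :
    ((psi k σ).submatrix id ![c, d]).det ≠ 0 := by
  rw [minor_eq, sub_ne_zero]
  intro h'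
  have := (diagonal_lt_antidiagonal h).ne
  rw [(monomial_left_inj one_ne_zero).1 h'] at this
  exact this rfl

/-! ### The two gradings: block degree and row weight -/

/-- The multidegree of a monomial, counting the variables in each block. -/
noncomputable def blockDegree (σ : Fin l → ℕ) : (Var σ →₀ ℕ) →+ (Fin l →₀ ℕ) :=
  Finsupp.weight fun v => Finsupp.single (ofLex v).1 1

/-- The weight of a monomial, where `T_{i,j}` (counted from `0`) has weight `σ_i - j`. -/
noncomputable def rowWeight (σ : Fin l → ℕ) : (Var σ →₀ ℕ) →+ ℕ :=
  Finsupp.weight fun v => σ (ofLex v).1 - (ofLex v).2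

/-- The contribution of a block to the weight of a monomial. -/
def blockWeight (M : Var σ →₀ ℕ) (i : Fin l) : ℕ :=
  ∑ j : Fin (σ i + 1), M (var σ i j) * (σ i - j)

theorem sum_var {β : Type*} [AddCommMonoid β] (f : Var σ → β) :
    ∑ v, f v = ∑ i, ∑ j, f (var σ i j) := by
  rw [← Fintype.sum_sigma' (fun i j => f (var σ i j))]
  exact Fintype.sum_equiv ofLex _ _ fun v => rfl

theorem blockDegree_apply (M : Var σ →₀ ℕ) (i : Fin l) :
    blockDegree σ M i = ∑ j, M (var σ i j) := by
  rw [blockDegree, Finsupp.weight_eq_sum, Finsupp.finsetSum_apply, sum_var,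
    Finset.sum_eq_single i]
  · simp [var]
  · intro b _ hb
    simp [var, hb]
  · simp

theorem rowWeight_eq_sum (M : Var σ →₀ ℕ) : rowWeight σ M = ∑ i, blockWeight M i := by
  rw [rowWeight, Finsupp.weight_eq_sum, sum_var]
  rfl

@[simp] theorem blockDegree_single (i : Fin l) (j : Fin (σ i + 1)) (e : ℕ) :
    blockDegree σ (Finsupp.single (var σ i j) e) = Finsupp.single i e := by
  simp [blockDegree, Finsupp.weight_single, var]

@[simp] theorem rowWeight_single (i : Fin l) (j : Fin (σ i + 1)) (e : ℕ) :
    rowWeight σ (Finsupp.single (var σ i j) e) = e * (σ i - j) := by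
  simp [rowWeight, Finsupp.weight_single, var]

theorem blockDegree_diagonal (c d : Col σ) :
    blockDegree σ (diagonal c d) = blockDegree σ (antidiagonal c d) := by
  simp [diagonal, antidiagonal, top, bot]

theorem rowWeight_diagonal (c d : Col σ) :
    rowWeight σ (diagonal c d) = rowWeight σ (antidiagonal c d) := by
  simp only [diagonal, antidiagonal, top, bot, map_add, rowWeight_single, Fin.val_castSucc,
    Fin.val_succ]
  have h1 := (ofLex c).2.isLt
  have h2 := (ofLex d).2.isLt
  omega

/-- Consequently the weight of a block is maximal for its degree exactly when `T_{i,0}` is the only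
variable of the block that occurs. -/
theorem blockWeight_add_sum (M : Var σ →₀ ℕ) (i : Fin l) :
    blockWeight M i + ∑ j : Fin (σ i + 1), M (var σ i j) * j = blockDegree σ M i * σ i := by
  rw [blockDegree_apply, blockWeight, ← Finset.sum_add_distrib, Finset.sum_mul]
  refine Finset.sum_congr rfl fun j _ => ?_
  rw [← mul_add, Nat.sub_add_cancel (Nat.lt_succ_iff.1 j.isLt)]

/-! ### Standard monomials -/

/-- A monomial is standard if it is divisible by no leading monomial of a minor. -/
def IsStandard (M : Var σ →₀ ℕ) : Prop :=
  ∀ c d : Col σ, c < d → ¬ antidiagonal c d ≤ M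

theorem le_of_apply_ne_zero {ι : Type*} {M : ι →₀ ℕ} {v w : ι} (hv : M v ≠ 0) (hw : M w ≠ 0)
    (h : v = w → 2 ≤ M v) : Finsupp.single v 1 + Finsupp.single w 1 ≤ M := by
  classical
  intro x
  rw [Finsupp.add_apply, Finsupp.single_apply, Finsupp.single_apply]
  split_ifs with h1 h2 h2
  · subst h1; exact h h2.symm
  · subst h1; omega
  · subst h2; omega
  · omega

/-- For `j > 0` the variable `T_{i,j}` is a bottom entry, and a non-last `T_{i',j'}` is a top entry
of a later column; their product would be an antidiagonal. -/
theorem IsStandard.eq_last {M : Var σ →₀ ℕ} (hM : IsStandard M) {i i' : Fin l} (h : i < i')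
    {j : Fin (σ i + 1)} (hj : j ≠ 0) (hMj : M (var σ i j) ≠ 0) {j' : Fin (σ i' + 1)}
    (hMj' : M (var σ i' j') ≠ 0) : j' = Fin.last _ := by
  by_contra hne
  obtain ⟨a, rfl⟩ := Fin.exists_succ_eq.2 hj
  obtain ⟨b, rfl⟩ := Fin.exists_castSucc_eq.2 hne
  refine hM (toLex ⟨i, a⟩) (toLex ⟨i', b⟩) (Sigma.Lex.left _ _ h)
    (le_of_apply_ne_zero hMj hMj' fun hvw => ?_)
  exact absurd (var_injective hvw).1 h.ne

/-- `T_{i,j}` is the bottom of column `j - 1` and `T_{i,j'}` the top of the later column `j'`. So a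
block contains at most one interior variable, with exponent one. -/
theorem IsStandard.interior {M : Var σ →₀ ℕ} (hM : IsStandard M) {i : Fin l}
    {j j' : Fin (σ i + 1)} (hj : j ≠ 0) (hjj : j ≤ j') (hj' : j' ≠ Fin.last _)
    (hMj : M (var σ i j) ≠ 0) (hMj' : M (var σ i j') ≠ 0) : j = j' ∧ M (var σ i j) = 1 := by
  by_contra hne
  obtain ⟨a, rfl⟩ := Fin.exists_succ_eq.2 hj
  obtain ⟨b, rfl⟩ := Fin.exists_castSucc_eq.2 hj'
  refine hM (toLex ⟨i, a⟩) (toLex ⟨i, b⟩) (Sigma.Lex.right _ _ ?_)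
    (le_of_apply_ne_zero hMj hMj' fun hvw => ?_)
  · rw [Fin.le_def] at hjj
    rw [Fin.lt_def]
    simp at hjj
    omega
  · have := var_inj.1 hvw
    have h2 : M (var σ i a.succ) ≠ 1 := fun h => hne ⟨this, h⟩
    change 2 ≤ M (var σ i a.succ)
    omega

/-- A block of non-maximal weight contains some `T_{i,j}` with `j > 0`, so later blocks contain only
last variables, of weight `0`. The block weights are thus filled greedily: maximal, then at most one
intermediate value, then zeros. -/
theorem IsStandard.blockWeight_eq_zero {M : Var σ →₀ ℕ} (hM : IsStandard M) {i i' : Fin l}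
    (h : i < i') (hi : blockWeight M i ≠ blockDegree σ M i * σ i) : blockWeight M i' = 0 := by
  have h1 : ∑ j : Fin (σ i + 1), M (var σ i j) * j ≠ 0 := by
    have := blockWeight_add_sum M i
    omega
  obtain ⟨j, -, hj⟩ := Finset.exists_ne_zero_of_sum_ne_zero h1
  obtain ⟨hj1, hj2⟩ := mul_ne_zero_iff.1 hj
  refine Finset.sum_eq_zero fun j' _ => ?_
  rcases eq_or_ne (M (var σ i' j')) 0 with h0 | h0
  · simp [h0]
  · rw [hM.eq_last h (fun h => hj2 (by simp [h])) hj1 h0]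
    simp

theorem blockWeight_le (M : Var σ →₀ ℕ) (i : Fin l) :
    blockWeight M i ≤ blockDegree σ M i * σ i := by
  have := blockWeight_add_sum M i
  omega

/-- Block `i` of `M` is not maximal, so all later blocks of `M` weigh `0` and cannot make up the
deficit. -/
theorem rowWeight_lt_of_blockWeight_lt {M N : Var σ →₀ ℕ} (hM : IsStandard M)
    (hd : blockDegree σ M = blockDegree σ N) {i : Fin l}
    (hlt : ∀ j < i, blockWeight M j = blockWeight N j) (hi : blockWeight M i < blockWeight N i) :
    rowWeight σ M < rowWeight σ N := by
  rw [rowWeight_eq_sum, rowWeight_eq_sum]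
  refine Finset.sum_lt_sum (fun j _ => ?_) ⟨i, Finset.mem_univ _, hi⟩
  rcases lt_trichotomy j i with h | rfl | h
  · exact (hlt j h).le
  · exact hi.le
  · have := blockWeight_le N i
    rw [hM.blockWeight_eq_zero h (by rw [hd]; omega)]
    exact Nat.zero_le _

theorem IsStandard.blockWeight_eq {M N : Var σ →₀ ℕ} (hM : IsStandard M) (hN : IsStandard N)
    (hd : blockDegree σ M = blockDegree σ N) (hw : rowWeight σ M = rowWeight σ N) (i : Fin l) :
    blockWeight M i = blockWeight N i := by
  induction i using WellFoundedLT.induction with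
  | ind i ih =>
    rcases lt_trichotomy (blockWeight M i) (blockWeight N i) with h | h | h
    · exact absurd hw (rowWeight_lt_of_blockWeight_lt hM hd ih h).ne
    · exact h
    · exact absurd hw (rowWeight_lt_of_blockWeight_lt hN hd.symm
        (fun j hj => (ih j hj).symm) h).ne'

theorem IsStandard.eq_of_interior {M : Var σ →₀ ℕ} (hM : IsStandard M) {i : Fin l}
    {j j' : Fin (σ i + 1)} (hj : j ≠ 0) (hj' : j' ≠ 0) (hl : j ≠ Fin.last _)
    (hl' : j' ≠ Fin.last _) (hMj : M (var σ i j) ≠ 0) (hMj' : M (var σ i j') ≠ 0) : j = j' := by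
  rcases le_total j j' with h | h
  · exact (hM.interior hj h hl' hMj hMj').1
  · exact (hM.interior hj' h hl hMj' hMj).1.symm

/-- In a standard monomial, the exponents of the variables `T_{i,j}` with `j > 0` are the digits
of the division with remainder of the sum of their indices by `σ_i`. -/
theorem IsStandard.apply_eq {M : Var σ →₀ ℕ} (hM : IsStandard M) {i : Fin l} (hi : 1 ≤ σ i)
    {j : Fin (σ i + 1)} (hj : j ≠ 0) :
    M (var σ i j) = if j = Fin.last _ then (∑ j : Fin (σ i + 1), M (var σ i j) * j) / σ i
      else if (∑ j : Fin (σ i + 1), M (var σ i j) * j) % σ i = j then 1 else 0 := by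
  by_cases hex : ∃ u : Fin (σ i + 1), u ≠ 0 ∧ u ≠ Fin.last _ ∧ M (var σ i u) ≠ 0
  · obtain ⟨u, hu, hul, hMu⟩ := hex
    have hMu1 := (hM.interior hu le_rfl hul hMu hMu).2
    -- The one interior variable is the remainder and the exponent of the last variable is the
    -- quotient.
    have hsum : ∑ j : Fin (σ i + 1), M (var σ i j) * j = u + σ i * M (var σ i (Fin.last _)) := by
      rw [Finset.sum_eq_add u (Fin.last _) hul]
      · rw [hMu1, Fin.val_last]; ring
      · rintro c - ⟨hc, hcl⟩
        by_contra h0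
        obtain ⟨h1, h2⟩ := mul_ne_zero_iff.1 h0
        exact hc (hM.eq_of_interior (fun h => h2 (by simp [h])) hu hcl hul h1 hMu)
      · simp
      · simp
    have hult : (u : ℕ) < σ i := Fin.val_lt_last hul
    rw [hsum, Nat.add_mul_div_left _ _ hi, Nat.add_mul_mod_self_left, Nat.div_eq_of_lt hult,
      Nat.mod_eq_of_lt hult]
    split_ifs with h1 h2
    · rw [h1, zero_add]
    · rw [← Fin.ext h2, hMu1]
    · by_contra h0
      exact h2 (by rw [hM.eq_of_interior hj hu h1 hul h0 hMu])
  · push Not at hex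
    have hsum : ∑ j : Fin (σ i + 1), M (var σ i j) * j = σ i * M (var σ i (Fin.last _)) := by
      rw [Finset.sum_eq_single (Fin.last _)]
      · rw [Fin.val_last]; ring
      · intro c _ hcl
        rcases eq_or_ne c 0 with rfl | hc
        · simp
        · simp [hex c hc hcl]
      · simp
    rw [hsum, Nat.mul_div_cancel_left _ hi, Nat.mul_mod_right]
    split_ifs with h1 h2
    · rw [h1]
    · exact absurd (Fin.ext h2.symm) hj
    · exact hex j hj h1

/-- Degree and weight fix the block weights, hence the index sums, hence the exponents with `j > 0`;
the block degree then gives that of `T_{i,0}`. -/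
theorem IsStandard.eq {M N : Var σ →₀ ℕ} (hσ : ∀ i, 1 ≤ σ i) (hM : IsStandard M)
    (hN : IsStandard N) (hd : blockDegree σ M = blockDegree σ N)
    (hw : rowWeight σ M = rowWeight σ N) : M = N := by
  have hsum (i) : ∑ j : Fin (σ i + 1), M (var σ i j) * j =
      ∑ j : Fin (σ i + 1), N (var σ i j) * j := by
    have h1 := blockWeight_add_sum M i
    have h2 := blockWeight_add_sum N i
    rw [← hd, ← hM.blockWeight_eq hN hd hw i, ← h1] at h2
    omega
  have hne (i) (j : Fin (σ i + 1)) (hj : j ≠ 0) : M (var σ i j) = N (var σ i j) := by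
    rw [hM.apply_eq (hσ i) hj, hN.apply_eq (hσ i) hj, hsum]
  have hall (i) (j : Fin (σ i + 1)) : M (var σ i j) = N (var σ i j) := by
    rcases eq_or_ne j 0 with rfl | hj
    · have h := DFunLike.congr_fun hd i
      rw [blockDegree_apply, blockDegree_apply, Fin.sum_univ_succ, Fin.sum_univ_succ,
        Finset.sum_congr rfl fun j _ => hne i _ (Fin.succ_ne_zero j)] at h
      exact Nat.add_right_cancel h
    · exact hne i j hj
  ext v
  exact hall (ofLex v).1 (ofLex v).2

/-- A standard monomial is the smallest one with its multidegree and weight. -/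
theorem IsStandard.le {M N : Var σ →₀ ℕ} (hσ : ∀ i, 1 ≤ σ i) (hM : IsStandard M)
    (hd : blockDegree σ M = blockDegree σ N) (hw : rowWeight σ M = rowWeight σ N) :
    (degRevLex (Var σ)).toSyn M ≤ (degRevLex (Var σ)).toSyn N := by
  induction h : (degRevLex (Var σ)).toSyn N using WellFoundedLT.induction generalizing N with
  | ind y ih =>
    subst h
    by_cases hN : IsStandard N
    · rw [hM.eq hσ hN hd hw]
    · unfold IsStandard at hN
      push Not at hN
      obtain ⟨c, d, hcd, hle⟩ := hN
      obtain ⟨e, rfl⟩ := exists_add_of_le hle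
      -- Straightening: replacing an antidiagonal by its diagonal preserves both gradings and
      -- strictly lowers the monomial.
      have hlt : (degRevLex (Var σ)).toSyn (diagonal c d + e) <
          (degRevLex (Var σ)).toSyn (antidiagonal c d + e) := by
        rw [map_add, map_add]
        exact add_lt_add_left (diagonal_lt_antidiagonal hcd) _
      refine (ih _ hlt ?_ ?_ rfl).trans hlt.le
      · rw [hd, map_add, map_add, blockDegree_diagonal]
      · rw [hw, map_add, map_add, rowWeight_diagonal]

/-! ### Standard monomials of large weight and the list `𝓛` -/

/-- The exponent of the monomial `T^a T_{m,0}^f T_{m,u}` (indices counted from `0`). -/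
noncomputable def exponent (m : Fin l) (a : Fin m → ℕ) (f : ℕ) (u : Fin (σ m + 1)) :
    Var σ →₀ ℕ :=
  ∑ i : Fin m, Finsupp.single (var σ (i.castLE m.isLt.le) 0) (a i) +
    Finsupp.single (var σ m 0) f + Finsupp.single (var σ m u) 1

theorem monomial_exponent (k : Type*) [Field k] (m : Fin l) (a : Fin m → ℕ) (f : ℕ)
    (u : Fin (σ m + 1)) :
    (∏ i : Fin m, X (var σ (i.castLE m.isLt.le) 0) ^ a i) * X (var σ m 0) ^ f * X (var σ m u) =
      monomial (exponent m a f u) (1 : k) := by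
  simp only [exponent, X, monomial_pow, one_pow, ← monomial_sum_one, monomial_mul, mul_one,
    Finsupp.smul_single, smul_eq_mul]

theorem rowWeight_exponent (m : Fin l) (a : Fin m → ℕ) (f : ℕ) (u : Fin (σ m + 1)) :
    rowWeight σ (exponent m a f u) = weight σ m a + f * σ m + (σ m - u) := by
  simp [exponent, weight]

theorem exponent_le {M : Var σ →₀ ℕ} {m : Fin l} {a : Fin m → ℕ} {f : ℕ} {u : Fin (σ m + 1)}
    (ha : ∀ i, a i ≤ M (var σ (i.castLE m.isLt.le) 0))
    (h : Finsupp.single (var σ m 0) f + Finsupp.single (var σ m u) 1 ≤ M) :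
    exponent m a f u ≤ M := by
  classical
  intro x
  rw [exponent, add_assoc, Finsupp.add_apply, Finsupp.finsetSum_apply]
  by_cases hx : ∃ i : Fin m, var σ (i.castLE m.isLt.le) 0 = x
  · obtain ⟨i, rfl⟩ := hx
    rw [Finset.sum_eq_single i]
    · have hne (j : Fin (σ m + 1)) : var σ (i.castLE m.isLt.le) 0 ≠ var σ m j := fun h => by
        have := congrArg Fin.val (var_injective h).1
        have := i.isLt
        simp at *
        omega
      simp [(hne _).symm, ha]
    · intro b _ hb
      rw [Finsupp.single_eq_of_ne]
      intro h
      have := congrArg Fin.val (var_injective h).1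
      simp at this
      exact hb (Fin.ext this.symm)
    · simp
  · push Not at hx
    rw [Finset.sum_eq_zero fun i _ => Finsupp.single_eq_of_ne (hx i).symm, zero_add]
    exact h x

theorem blockWeight_eq_of_eq_mul {M : Var σ →₀ ℕ} {i : Fin l}
    (h : blockWeight M i = blockDegree σ M i * σ i) :
    blockWeight M i = M (var σ i 0) * σ i := by
  have h0 : ∑ j : Fin (σ i + 1), M (var σ i j) * j = 0 := by
    have := blockWeight_add_sum M i
    omega
  rw [blockWeight, Finset.sum_eq_single 0]
  · simp
  · intro j _ hj
    have := Finset.sum_eq_zero_iff.1 h0 j (Finset.mem_univ _)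
    rcases mul_eq_zero.1 this with h | h
    · simp [h]
    · exact absurd (Fin.ext h) hj
  · simp

theorem exists_prefix (w : Fin l → ℕ) {n : ℕ} (hn : 1 ≤ n) (h : n ≤ ∑ i, w i) :
    ∃ m : Fin l, ∑ i : Fin m, w (i.castLE m.isLt.le) < n ∧
      n ≤ ∑ i : Fin m, w (i.castLE m.isLt.le) + w m := by
  classical
  let g : ℕ → ℕ := fun t => ∑ i ∈ Finset.range t, if h : i < l then w ⟨i, h⟩ else 0
  have hgl : g l = ∑ i, w i := by
    simp [g, Finset.sum_range]
  have hg (m : Fin l) : g m = ∑ i : Fin m, w (i.castLE m.isLt.le) := by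
    simp only [g, Finset.sum_range]
    refine Finset.sum_congr rfl fun i _ => ?_
    rw [dif_pos (i.isLt.trans m.isLt)]
    rfl
  have hex : ∃ t, n ≤ g t := ⟨l, hgl ▸ h⟩
  have hle : Nat.find hex ≤ l := Nat.find_min' hex (hgl ▸ h)
  have hspec := Nat.find_spec hex
  obtain ⟨s, hs⟩ : ∃ s, Nat.find hex = s + 1 := by
    refine Nat.exists_eq_succ_of_ne_zero fun h0 => ?_
    rw [h0] at hspec
    simp [g] at hspec
    omega
  have hmin : ¬ n ≤ g s := Nat.find_min hex (by omega)
  rw [hs] at hspec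
  have hsl : s < l := by omega
  refine ⟨⟨s, hsl⟩, ?_⟩
  rw [← hg]
  refine ⟨not_le.1 hmin, hspec.trans_eq ?_⟩
  simp only [g, Finset.sum_range_succ, dif_pos hsl]

/-- Take for `m` the block at which the accumulated block weights reach `n`, and for `a` the
exponents of the `T_{i,0}` before it. -/
theorem IsStandard.exists_exponent_le {M : Var σ →₀ ℕ} (hσ : ∀ i, 1 ≤ σ i) (hM : IsStandard M)
    {n : ℕ} (hn : 1 ≤ n) (hw : n ≤ rowWeight σ M) :
    ∃ (m : Fin l) (a : Fin m → ℕ) (u : Fin (σ m + 1)), Eligible σ n m a ∧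
      (u : ℕ) + 1 ≤ eligibleR σ n m a ∧ exponent m a (eligibleF σ n m a) u ≤ M := by
  rw [rowWeight_eq_sum] at hw
  obtain ⟨m, hm1, hm2⟩ := exists_prefix (blockWeight M) hn hw
  have hbw (i : Fin m) : blockWeight M (i.castLE m.isLt.le) =
      M (var σ (i.castLE m.isLt.le) 0) * σ (i.castLE m.isLt.le) := by
    refine blockWeight_eq_of_eq_mul ?_
    -- Block `m` has positive weight, so every earlier block must be maximal.
    by_contra hne
    have := hM.blockWeight_eq_zero (i' := m) (by rw [Fin.lt_def]; simp) hne
    omega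
  rw [Finset.sum_congr rfl fun i _ => hbw i] at hm1 hm2
  set a : Fin m → ℕ := fun i => M (var σ (i.castLE m.isLt.le) 0) with ha
  change weight σ m a < n at hm1
  change n ≤ weight σ m a + _ at hm2
  obtain ⟨hf1, hf2⟩ := eligibleF_spec σ n m a (hσ m) hm1
  -- If the powers of `T_{m,0}` alone reach `n`, then `T_{m,0}^{f+1}` divides `M` and `u = 0` works.
  -- Otherwise the interior variable of block `m` is needed; it serves as `T_{m,u}`, and `f` is the
  -- full exponent of `T_{m,0}`.
  by_cases hp : n ≤ weight σ m a + M (var σ m 0) * σ m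
  · refine ⟨m, a, 0, hm1, ?_, exponent_le (fun i => le_rfl) ?_⟩
    · rw [eligibleR, Fin.val_zero]
      omega
    · rw [← Finsupp.single_add, Finsupp.single_le_iff]
      by_contra! hlt
      have := Nat.mul_le_mul_right (σ m) (Nat.lt_succ_iff.1 hlt)
      omega
  · have hex : ∃ u ∈ Finset.univ, u ≠ 0 ∧ M (var σ m u) * (σ m - u) ≠ 0 := by
      by_contra! hne
      have : blockWeight M m = M (var σ m 0) * σ m := by
        rw [blockWeight, Finset.sum_eq_single 0 hne (by simp)]
        simp
      omega
    obtain ⟨u, -, hu, hMu⟩ := hex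
    obtain ⟨hMu1, hMu2⟩ := mul_ne_zero_iff.1 hMu
    have hul : u ≠ Fin.last _ := fun h => hMu2 (by simp [h])
    have hb : blockWeight M m = M (var σ m 0) * σ m + (σ m - u) := by
      rw [blockWeight, Finset.sum_eq_add 0 u hu.symm _ (by simp) (by simp),
        (hM.interior hu le_rfl hul hMu1 hMu1).2]
      · simp
      · rintro c - ⟨hc, hcu⟩
        by_contra h0
        obtain ⟨h1, h2⟩ := mul_ne_zero_iff.1 h0
        exact hcu (hM.eq_of_interior hc hu (fun h => h2 (by simp [h])) hul h1 hMu1)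
    have hus : (u : ℕ) ≤ σ m := Nat.lt_succ_iff.1 u.isLt
    have hf : eligibleF σ n m a = M (var σ m 0) :=
      eligibleF_unique σ n m a _ (not_le.1 hp) (by rw [add_mul]; omega)
    refine ⟨m, a, u, hm1, ?_, exponent_le (fun i => le_rfl) ?_⟩
    · rw [eligibleR, hf, add_mul]
      omega
    · rw [hf]
      classical
      intro x
      rw [Finsupp.add_apply, Finsupp.single_apply, Finsupp.single_apply]
      split_ifs with h1 h2 h2
      · exact absurd (var_inj.1 (h2.trans h1.symm)) hu
      · rw [← h1, add_zero]
      · rw [← h2]; omega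
      · omega

end Scroll

namespace Scroll

variable {l : ℕ}

/-! ### The parametrization and the symbolic powers of `K` -/

/-- The parametrization `T_{i,j} ↦ x_i s^{σ_i - j}` of the scroll (indices counted from `0`). -/
noncomputable def param (k : Type*) [Field k] (σ : Fin l → ℕ) :
    MvPolynomial (Var σ) k →ₐ[k] Polynomial (MvPolynomial (Fin l) k) :=
  aeval fun v => Polynomial.monomial (σ (ofLex v).1 - (ofLex v).2) (X (ofLex v).1)

variable {k : Type*} [Field k] {σ : Fin l → ℕ}

theorem param_monomial (M : Var σ →₀ ℕ) (c : k) :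
    param k σ (monomial M c) =
      Polynomial.monomial (rowWeight σ M) (monomial (blockDegree σ M) c) := by
  have h1 : param k σ (monomial M 1) =
      Polynomial.monomial (rowWeight σ M) (monomial (blockDegree σ M) 1) := by
    induction M using Finsupp.induction_linear with
    | zero => simp
    | add M N hM hN =>
      rw [← one_mul (1 : k), ← monomial_mul, map_mul, hM, hN, Polynomial.monomial_mul_monomial,
        monomial_mul, map_add, map_add]
    | single v e =>
      rw [← X_pow_eq_monomial, map_pow, param, aeval_X, Polynomial.monomial_pow, X, monomial_pow]
      simp [rowWeight, blockDegree, Finsupp.weight_single, mul_comm]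
  rw [← mul_one c, ← smul_eq_mul, ← smul_monomial, map_smul, h1, ← smul_monomial,
    Polynomial.smul_monomial]

theorem H_le_ker_param : H k σ ≤ RingHom.ker (param k σ) := by
  rw [H, Ideal.span_le]
  rintro _ ⟨c, d, -, rfl⟩
  rw [SetLike.mem_coe, RingHom.mem_ker, minor_eq, map_sub, param_monomial, param_monomial,
    rowWeight_diagonal, blockDegree_diagonal, sub_self]

/-- The preimage of `K` consists of the polynomials vanishing at `s = 0`. -/
theorem mk_mem_K_of_dvd {p : MvPolynomial (Var σ) k} (hp : Polynomial.X ∣ param k σ p) :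
    Ideal.Quotient.mk (H k σ) p ∈ K k σ := by
  let lift : MvPolynomial (Fin l) k →ₐ[k] MvPolynomial (Var σ) k :=
    aeval fun i => X (var σ i (Fin.last _))
  let π : MvPolynomial (Var σ) k →ₐ[k] (A k σ ⧸ K k σ) :=
    (Ideal.Quotient.mkₐ k (K k σ)).comp (Ideal.Quotient.mkₐ k (H k σ))
  let ev : Polynomial (MvPolynomial (Fin l) k) →ₐ[k] MvPolynomial (Fin l) k :=
    (Polynomial.aeval (0 : MvPolynomial (Fin l) k)).restrictScalars k
  -- At `s = 0` only the last variables survive, as `x_i`, and modulo `K` all the others vanish. So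
  -- the value at `s = 0` determines the class modulo `K`.
  have hcomp : (π.comp lift).comp (ev.comp (param k σ)) = π := by
    ext v
    obtain ⟨i, j⟩ := v
    change π (lift (ev (param k σ (X (var σ i j))))) = π (X (var σ i j))
    have hv : param k σ (X (var σ i j)) = Polynomial.monomial (σ i - j) (X i) := by
      simp [param, var]
    rw [hv]
    rcases eq_or_ne j (Fin.last _) with rfl | hj
    · simp [ev, lift]
    · have h1 : ev (Polynomial.monomial (σ i - j) (X i)) = 0 := by
        have h0 : σ i - (j : ℕ) ≠ 0 := Nat.sub_ne_zero_of_lt (Fin.val_lt_last hj)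
        simp [ev, Polynomial.aeval_monomial, h0]
      rw [h1, map_zero, map_zero]
      obtain ⟨b, rfl⟩ := Fin.exists_castSucc_eq.2 hj
      have hb : Ideal.Quotient.mk (H k σ) (X (var σ i b.castSucc)) ∈ K k σ :=
        Ideal.subset_span ⟨toLex ⟨i, b⟩, rfl⟩
      exact (Ideal.Quotient.eq_zero_iff_mem.2 hb).symm
  have h := DFunLike.congr_fun hcomp p
  obtain ⟨q, hq⟩ := hp
  have hev : ev (param k σ p) = 0 := by simp [hq, ev]
  change π (lift (ev (param k σ p))) = π p at h
  rw [hev, map_zero, map_zero] at h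
  exact Ideal.Quotient.eq_zero_iff_mem.1 h.symm

theorem mem_symbolicPower_iff {B : Type*} [CommRing B] (P : Ideal B) [P.IsPrime] (n : ℕ) (x : B) :
    x ∈ symbolicPower P n ↔ ∃ s ∉ P, s * x ∈ P ^ n := by
  rw [symbolicPower, Ideal.mem_comap,
    IsLocalization.algebraMap_mem_map_algebraMap_iff P.primeCompl]
  rfl

/-- The induced parametrization of the coordinate ring of the scroll. -/
noncomputable def paramA (k : Type*) [Field k] (σ : Fin l → ℕ) :
    A k σ →+* Polynomial (MvPolynomial (Fin l) k) :=
  Ideal.Quotient.lift (H k σ) (param k σ).toRingHom fun _ h => H_le_ker_param h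

theorem K_le_comap_span_X : K k σ ≤ (Ideal.span {Polynomial.X}).comap (paramA k σ) := by
  rw [K, Ideal.span_le]
  rintro _ ⟨c, rfl⟩
  change param k σ (X (top c)) ∈ Ideal.span {Polynomial.X}
  rw [Ideal.mem_span_singleton, param, aeval_X, Polynomial.X_dvd_iff, Polynomial.coeff_monomial,
    if_neg]
  have := (ofLex c).2.isLt
  change σ (ofLex c).1 - ((ofLex c).2 : ℕ) ≠ 0
  omega

/-- A multiplier outside `K` has image not divisible by the prime `Polynomial.X`, so the whole power
divides the other factor. -/
theorem X_pow_dvd_param {n : ℕ} {p : MvPolynomial (Var σ) k}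
    (hp : Ideal.Quotient.mk (H k σ) p ∈ symbolicPower (K k σ) n) :
    Polynomial.X ^ n ∣ param k σ p := by
  obtain ⟨s, hs, hsp⟩ := (mem_symbolicPower_iff _ _ _).1 hp
  obtain ⟨s, rfl⟩ := Ideal.Quotient.mk_surjective s
  have h1 := Ideal.le_comap_pow (paramA k σ) n (Ideal.pow_right_mono K_le_comap_span_X n hsp)
  rw [Ideal.span_singleton_pow, Ideal.mem_comap, ← map_mul, Ideal.mem_span_singleton] at h1
  change _ ∣ param k σ (s * p) at h1
  rw [map_mul] at h1
  exact Polynomial.prime_X.pow_dvd_of_dvd_mul_left n (fun h => hs (mk_mem_K_of_dvd h)) h1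

theorem mul_mem_pow_add {B : Type*} [CommRing B] {P : Ideal B} {x y : B} {m n : ℕ}
    (hx : x ∈ P ^ m) (hy : y ∈ P ^ n) : x * y ∈ P ^ (m + n) :=
  pow_add P m n ▸ Ideal.mul_mem_mul hx hy

theorem pow_mem_pow_mul {B : Type*} [CommRing B] {P : Ideal B} {x : B} {m : ℕ}
    (hx : x ∈ P ^ m) (e : ℕ) : x ^ e ∈ P ^ (m * e) :=
  pow_mul P m e ▸ Ideal.pow_mem_pow hx e

/-- A variable of weight `w` lies in the `w`-th power of `K`, up to a power of a unit at `K`. -/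
theorem mul_last_pow_mem (i : Fin l) (w : ℕ) (j : Fin (σ i + 1)) (hw : σ i - j = w) :
    Ideal.Quotient.mk (H k σ) (X (var σ i (Fin.last _)) ^ w * X (var σ i j)) ∈ K k σ ^ w := by
  induction w generalizing j with
  | zero => simp
  | succ w ih =>
    have hj : (j : ℕ) < σ i := by omega
    have hj' := ih ⟨j + 1, by omega⟩ (by simp; omega)
    let c : Col σ := toLex ⟨i, ⟨j, hj⟩⟩
    let d : Col σ := toLex ⟨i, ⟨σ i - 1, by omega⟩⟩
    have hbd : bot d = var σ i (Fin.last _) := by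
      simp only [bot, d, ofLex_toLex]
      exact congrArg _ (Fin.ext (by simp; omega))
    have hbc : bot c = var σ i ⟨j + 1, by omega⟩ := rfl
    have htc : top c = var σ i j := rfl
    -- With `d` the last column of block `i`, this minor trades `T_{i,j} T_{i,σ_i}` for `T_{i,j+1}
    -- T_{i,σ_i-1}`: a factor in `K` splits off and the weight drops by one. The case `c = d` is
    -- commutativity.
    have hmul : Ideal.Quotient.mk (H k σ) (X (top c) * X (bot d)) =
        Ideal.Quotient.mk (H k σ) (X (bot c) * X (top d)) := by
      rcases eq_or_ne c d with h | h
      · rw [h, mul_comm]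
      · have hcd : c < d := by
          refine lt_of_le_of_ne (Sigma.Lex.right _ _ ?_) h
          rw [Fin.le_def]
          simp
          omega
        rw [Ideal.Quotient.eq]
        have hm : ((psi k σ).submatrix id ![c, d]).det ∈ H k σ :=
          Ideal.subset_span ⟨c, d, hcd, rfl⟩
        rw [minor_eq, diagonal, antidiagonal, ← one_mul (1 : k), ← monomial_mul,
          ← monomial_mul] at hm
        exact hm
    have hd : Ideal.Quotient.mk (H k σ) (X (top d)) ∈ K k σ := Ideal.subset_span ⟨d, rfl⟩
    have heq : Ideal.Quotient.mk (H k σ) (X (var σ i (Fin.last _)) ^ (w + 1) * X (var σ i j)) =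
        Ideal.Quotient.mk (H k σ) (X (var σ i (Fin.last _)) ^ w * X (bot c)) *
          Ideal.Quotient.mk (H k σ) (X (top d)) := by
      rw [pow_succ, mul_assoc, ← hbd, mul_comm (X (bot d)) _, ← htc, map_mul, hmul, ← map_mul,
        ← map_mul, mul_assoc]
    rw [heq]
    exact mul_mem_pow_add hj' (by rwa [pow_one])

theorem X_last_notMem (i : Fin l) :
    Ideal.Quotient.mk (H k σ) (X (var σ i (Fin.last _))) ∉ K k σ := by
  intro h
  have h1 := K_le_comap_span_X h
  change param k σ _ ∈ Ideal.span {Polynomial.X} at h1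
  rw [Ideal.mem_span_singleton, param, aeval_X, Polynomial.X_dvd_iff] at h1
  simp [var] at h1

theorem exists_mul_monomial_mem (M : Var σ →₀ ℕ) :
    ∃ s ∉ K k σ, s * Ideal.Quotient.mk (H k σ) (monomial M 1) ∈ K k σ ^ rowWeight σ M := by
  induction M using Finsupp.induction_linear with
  | zero => exact ⟨1, (Ideal.ne_top_iff_one _).1 Ideal.IsPrime.ne_top', by simp⟩
  | add M N hM hN =>
    obtain ⟨s, hs, hsM⟩ := hM
    obtain ⟨t, ht, htN⟩ := hN
    refine ⟨s * t, fun h => (Ideal.IsPrime.mem_or_mem (K_isPrime k σ) h).elim hs ht, ?_⟩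
    rw [← one_mul (1 : k), ← monomial_mul, map_mul, map_add, mul_mul_mul_comm]
    exact mul_mem_pow_add hsM htN
  | single v e =>
    obtain ⟨i, j⟩ := v
    refine ⟨(Ideal.Quotient.mk (H k σ) (X (var σ i (Fin.last _))) ^ (σ i - j)) ^ e,
      fun h => X_last_notMem (k := k) i
        (Ideal.IsPrime.mem_of_pow_mem (K_isPrime k σ) _
          (Ideal.IsPrime.mem_of_pow_mem (K_isPrime k σ) _ h)), ?_⟩
    change _ * Ideal.Quotient.mk (H k σ) (monomial (Finsupp.single (var σ i j) e) 1) ∈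
      K k σ ^ rowWeight σ (Finsupp.single (var σ i j) e)
    rw [rowWeight_single, ← X_pow_eq_monomial, map_pow, ← mul_pow, ← map_pow, ← map_mul, mul_comm e]
    exact pow_mem_pow_mul (mul_last_pow_mem i _ j rfl) e

theorem monomial_mem_symbolicPower {n : ℕ} {M : Var σ →₀ ℕ} (h : n ≤ rowWeight σ M) :
    Ideal.Quotient.mk (H k σ) (monomial M 1) ∈ symbolicPower (K k σ) n := by
  obtain ⟨s, hs, hsM⟩ := exists_mul_monomial_mem (k := k) M
  exact (mem_symbolicPower_iff _ _ _).2 ⟨s, hs, Ideal.pow_le_pow_right h hsM⟩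

/-! ### Leading terms of the preimage -/

theorem le_rowWeight_degree {n : ℕ} (hσ : ∀ i, 1 ≤ σ i) {p : MvPolynomial (Var σ) k} (hp : p ≠ 0)
    (hdvd : Polynomial.X ^ n ∣ param k σ p)
    (hM : IsStandard ((degRevLex (Var σ)).degree p)) :
    n ≤ rowWeight σ ((degRevLex (Var σ)).degree p) := by
  classical
  set M := (degRevLex (Var σ)).degree p with hMdef
  -- Another monomial of `p` with the same gradings would be at least `M` since `M` is standard, and
  -- at most `M` since `M` leads; so nothing else contributes to this coefficient.
  have hcoeff : ((param k σ p).coeff (rowWeight σ M)).coeff (blockDegree σ M) = p.coeff M := by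
    conv_lhs => rw [p.as_sum]
    rw [map_sum, Polynomial.finsetSum_coeff, coeff_sum, Finset.sum_eq_single M]
    · rw [param_monomial, Polynomial.coeff_monomial_same, coeff_monomial, if_pos rfl]
    · intro N hN hne
      rw [param_monomial, Polynomial.coeff_monomial]
      split_ifs with hw
      · rw [coeff_monomial, if_neg]
        intro hd
        exact hne ((degRevLex (Var σ)).toSyn.injective
          (((degRevLex (Var σ)).le_degree hN).antisymm (hM.le hσ hd.symm hw.symm)))
      · simp
    · intro h
      exact absurd ((degRevLex (Var σ)).degree_mem_support hp) h
  by_contra! hlt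
  rw [Polynomial.X_pow_dvd_iff.1 hdvd _ hlt, coeff_zero] at hcoeff
  exact (degRevLex (Var σ)).coeff_degree_ne_zero_iff.2 hp hcoeff.symm

theorem leadingTerm_mem_span {ι : Type*} (m : MonomialOrder ι) {G : Set (MvPolynomial ι k)}
    {p g : MvPolynomial ι k} (hg : g ∈ G) (hg0 : g ≠ 0) (h : m.degree g ≤ m.degree p) :
    m.leadingTerm p ∈ Ideal.span (m.leadingTerm '' G) := by
  obtain ⟨e, he⟩ := exists_add_of_le h
  have : m.leadingTerm p =
      monomial e (m.leadingCoeff p * (m.leadingCoeff g)⁻¹) * m.leadingTerm g := by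
    rw [MonomialOrder.leadingTerm, MonomialOrder.leadingTerm, monomial_mul,
      inv_mul_cancel_right₀ (m.leadingCoeff_ne_zero_iff.2 hg0), he, add_comm]
  rw [this]
  exact Ideal.mul_mem_left _ _ (Ideal.subset_span ⟨g, hg, rfl⟩)

theorem finite_minors (k : Type*) [Field k] (σ : Fin l → ℕ) : (minors k σ).Finite := by
  refine (Set.finite_range fun c : Col σ × Col σ =>
    ((psi k σ).submatrix id ![c.1, c.2]).det).subset ?_
  rintro _ ⟨c, d, -, rfl⟩
  exact ⟨(c, d), rfl⟩

theorem finite_monomials (k : Type*) [Field k] (hσ : ∀ i, 1 ≤ σ i) (n : ℕ) :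
    (monomials k σ n).Finite := by
  have hfin : (⋃ m : Fin l, ⋃ u : Fin (σ m + 1),
      (fun a : Fin m → ℕ => (∏ i : Fin m, (X (var σ (i.castLE m.isLt.le) 0) :
        MvPolynomial (Var σ) k) ^ a i) * X (var σ m 0) ^ eligibleF σ n m a * X (var σ m u)) ''
        Set.Iic fun _ => n).Finite :=
    Set.finite_iUnion fun m => Set.finite_iUnion fun u => (Set.finite_Iic _).image _
  refine hfin.subset ?_
  rintro _ ⟨m, a, u, ha, -, rfl⟩
  refine Set.mem_iUnion₂.2 ⟨m, u, a, fun i => ?_, rfl⟩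
  have h1 : a i * σ (i.castLE m.isLt.le) ≤ weight σ m a :=
    Finset.single_le_sum (f := fun i : Fin m => a i * σ (i.castLE m.isLt.le))
      (fun _ _ => Nat.zero_le _) (Finset.mem_univ i)
  exact (Nat.le_mul_of_pos_right _ (hσ _)).trans (h1.trans (le_of_lt ha))

end Scroll

theorem theorem2p4 (k : Type*) [Field k] (l : ℕ) (hl : 1 ≤ l) (σ : Fin l → ℕ)
    (hσ : Antitone σ) (hσ1 : ∀ i, 1 ≤ σ i) (n : ℕ) (hn : 2 ≤ n) :
    IsGroebnerBasis (degRevLex (Scroll.Var σ))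
      (Scroll.minors k σ ∪ Scroll.monomials k σ n)
      ((symbolicPower (Scroll.K k σ) n).comap (Ideal.Quotient.mk (Scroll.H k σ))) := by
  classical
  have hsub : Scroll.minors k σ ∪ Scroll.monomials k σ n ⊆
      ((symbolicPower (Scroll.K k σ) n).comap (Ideal.Quotient.mk (Scroll.H k σ)) :
        Set (MvPolynomial (Scroll.Var σ) k)) := by
    rintro g (hg | ⟨m, a, u, ha, hu, rfl⟩)
    · have hgH : g ∈ Scroll.H k σ := Ideal.subset_span hg
      rw [SetLike.mem_coe, Ideal.mem_comap, Ideal.Quotient.eq_zero_iff_mem.2 hgH]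
      exact zero_mem _
    · rw [Scroll.monomial_exponent]
      refine Scroll.monomial_mem_symbolicPower ?_
      rw [Scroll.rowWeight_exponent]
      -- As `u ≤ σ_m`, the bound `u + 1 ≤ r(a)` says precisely that the row weight is at least `n`.
      have h1 := (Scroll.eligibleF_spec σ n m a (hσ1 m) ha).2
      rw [Scroll.eligibleR] at hu
      rw [add_mul, one_mul] at hu h1
      have := u.isLt
      omega
  refine ⟨(Scroll.finite_minors k σ).union (Scroll.finite_monomials k hσ1 n), hsub,
    le_antisymm (Ideal.span_mono (Set.image_mono hsub)) (Ideal.span_le.2 ?_)⟩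
  rintro _ ⟨p, hp, rfl⟩
  rcases eq_or_ne p 0 with rfl | hp0
  · simp
  by_cases hst : Scroll.IsStandard ((degRevLex (Scroll.Var σ)).degree p)
  · obtain ⟨m, a, u, ha, hu, hle⟩ := hst.exists_exponent_le hσ1 (by omega : 1 ≤ n)
      (Scroll.le_rowWeight_degree hσ1 hp0 (Scroll.X_pow_dvd_param hp) hst)
    refine Scroll.leadingTerm_mem_span _ (Or.inr ⟨m, a, u, ha, hu, rfl⟩) ?_ ?_
    · rw [Scroll.monomial_exponent]
      simp
    · rw [Scroll.monomial_exponent, MonomialOrder.degree_monomial, if_neg one_ne_zero]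
      exact hle
  · unfold Scroll.IsStandard at hst
    push Not at hst
    obtain ⟨c, d, hcd, hle⟩ := hst
    refine Scroll.leadingTerm_mem_span _ (Or.inl ⟨c, d, hcd, rfl⟩)
      (Scroll.minor_ne_zero k hcd) ?_
    rwa [Scroll.degree_minor k hcd]
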